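/- Let $X$ be a smooth Calabi--Yau threefold, i.e. a smooth projective complex variety of dimension three with $\omega_X\cong\mathcal O_X$ and $H^1(X,\mathcal O_X)=H^2(X,\mathcal O_X)=0$. Let $\mathrm{Cl}(X)$ be its divisor class group. The effective cone $\mathcal E_X\subset \mathrm{Cl}(X)\otimes\mathbb R$ is the set of non-negative real combinations of classes of prime divisors. A class $[D]\in\mathrm{Cl}(X)$ is effective if it contains a divisor with non-negative coefficients, and a hole is a class $[D]\in\mathrm{Cl}(X)$ whose image lies in $\mathcal E_X$ but which is not effective. The movable cone is the cone in $\mathrm{Cl}(X)\otimes\mathbb R$ generated by the effective divisor classes whose base locus has codimension at least two, and a class is called movable if its image lies in the movable cone. The stable base locus of $[D]$ is the intersection over all $m\ge 1$ of the base loci of $m[D]$. (1) Let $[D]$ be a non-movable hole on $X$. Then the prime divisors contained in the stable base locus of $[D]$ are finite in number and at least one; call them $E_1,\dots,E_n$. For all integers $a_1,\dots,a_n\ge 0$, $$h^0\Big(X,\mathcal O_X\Big(D+\sum_i a_iE_i\Big)\Big)=h^0(X,\mathcal O_X(D)),$$ and $[D+\sum_i a_iE_i]$ is again a non-movable hole.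 (2) If every movable class in $\mathrm{Cl}(X)$ is effective (in particular, if it is true that movable classes are effective on all smooth Calabi--Yau threefolds), then the conclusions of (1) hold for every hole $[D]$ on $X$. -/

import Mathlib

open AlgebraicGeometry CategoryTheory TopologicalSpace Order
open scoped TensorProduct KaehlerDifferential

noncomputable section

namespace CYHoles

/-! ### Weil divisors on a Noetherian integral scheme -/

/-- A prime divisor, given by its generic point: integral closed subschemes of codimension one
correspond to points `x` whose closure has codimension one. -/
def PrimeDivisor (X : Scheme.{0}) : Type := {x : X // coheight x = 1}

/-- Weil divisors: finite integral combinations of prime divisors. -/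
abbrev WeilDivisor (X : Scheme.{0}) : Type := PrimeDivisor X →₀ ℤ

section Divisors

variable (X : Scheme.{0}) [IsIntegral X] [IsLocallyNoetherian X]

/-- The subgroup of divisors of the form `div f`, for a nonzero rational function `f`. -/
def principalDivisors : AddSubgroup (WeilDivisor X) where
  carrier := {D | ∃ f : X.functionField, f ≠ 0 ∧ ∀ E : PrimeDivisor X, D E = Scheme.ord f E.1}
  zero_mem' := by
    refine ⟨1, one_ne_zero, fun E => ?_⟩
    have h := Scheme.ord_mul (X := X) (x := E.1) (f := 1) (g := 1) one_ne_zero one_ne_zero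
    rw [mul_one] at h
    simp only [Finsupp.coe_zero, Pi.zero_apply]
    omega
  add_mem' := by
    rintro D D' ⟨f, hf, hD⟩ ⟨g, hg, hD'⟩
    refine ⟨f * g, mul_ne_zero hf hg, fun E => ?_⟩
    rw [Scheme.ord_mul hf hg, Finsupp.add_apply, hD, hD']
  neg_mem' := by
    rintro D ⟨f, hf, hD⟩
    refine ⟨f⁻¹, inv_ne_zero hf, fun E => ?_⟩
    have h := Scheme.ord_mul (X := X) (x := E.1) hf (inv_ne_zero hf)
    have h1 := Scheme.ord_mul (X := X) (x := E.1) (f := 1) (g := 1) one_ne_zero one_ne_zero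
    rw [mul_one] at h1
    rw [mul_inv_cancel₀ hf] at h
    rw [Finsupp.neg_apply, hD]
    omega

/-- The group of divisor classes. -/
abbrev DivisorClass : Type := WeilDivisor X ⧸ principalDivisors X

/-- Divisor classes with real coefficients. -/
abbrev RealClass : Type := ℝ ⊗[ℤ] DivisorClass X

variable {X}

/-- The class `[D]` of a divisor. -/
abbrev divisorClass (D : WeilDivisor X) : DivisorClass X := QuotientAddGroup.mk D

/-- The image of a divisor class in the real vector space of divisor classes. -/
def DivisorClass.toReal (c : DivisorClass X) : RealClass X := (1 : ℝ) ⊗ₜ[ℤ] c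

/-- A divisor class is effective if it contains a divisor with non-negative coefficients. -/
def IsEffectiveClass (c : DivisorClass X) : Prop :=
  ∃ D : WeilDivisor X, 0 ≤ D ∧ divisorClass D = c

variable (X) in
/-- The effective cone: non-negative real combinations of classes of prime divisors. -/
def effectiveCone : PointedCone ℝ (RealClass X) :=
  PointedCone.hull ℝ
    (Set.range fun E : PrimeDivisor X =>
      DivisorClass.toReal (divisorClass (Finsupp.single E 1 : WeilDivisor X)))

/-- A hole: a divisor class which lies in the effective cone but is not effective. -/
def IsHole (c : DivisorClass X) : Prop :=
  c.toReal ∈ effectiveCone X ∧ ¬ IsEffectiveClass c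

/-- The nonzero global sections of `𝒪_X(D)`: rational functions `f ≠ 0` with `div f + D ≥ 0`. -/
def IsNonzeroSection (D : WeilDivisor X) (f : X.functionField) : Prop :=
  f ≠ 0 ∧ ∀ E : PrimeDivisor X, 0 ≤ Scheme.ord f E.1 + D E

/-- The base locus of `D`: the points at which every global section `f` of `𝒪_X(D)` vanishes,
i.e. which lie on a prime divisor occurring in the effective divisor `div f + D`
(it is all of `X` if there is no nonzero section). -/
def baseLocus (D : WeilDivisor X) : Set X :=
  {x | ∀ f : X.functionField, IsNonzeroSection D f →
    ∃ E : PrimeDivisor X, Scheme.ord f E.1 + D E ≠ 0 ∧ x ∈ closure {E.1}}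

/-- The stable base locus: the intersection of the base loci of all positive multiples. -/
def stableBaseLocus (D : WeilDivisor X) : Set X :=
  ⋂ m : ℕ, ⋂ _ : 0 < m, baseLocus (m • D)

/-- The prime divisors contained in the stable base locus. If some positive multiple of `D` has a
nonzero section, then these are the codimension-one irreducible components of that locus. -/
def stableBaseComponents (D : WeilDivisor X) : Set (PrimeDivisor X) :=
  {E | closure {E.1} ⊆ stableBaseLocus D}

/-- The movable cone: the cone generated by the effective divisor classes whose base locus has
codimension at least two. -/
def movableCone (X : Scheme.{0}) [IsIntegral X] [IsLocallyNoetherian X] :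
    PointedCone ℝ (RealClass X) :=
  PointedCone.hull ℝ {v | ∃ D : WeilDivisor X, IsEffectiveClass (divisorClass D) ∧
    (∀ x ∈ baseLocus D, 2 ≤ coheight x) ∧ v = DivisorClass.toReal (divisorClass D)}

/-- A class is called movable if it belongs to the movable cone. -/
def IsMovableClass (c : DivisorClass X) : Prop := c.toReal ∈ movableCone X

end Divisors

/-! ### Complex varieties -/

/-- The base `Spec ℂ`. -/
abbrev SpecC : Scheme.{0} := Spec (CommRingCat.of ℂ)

/-- The function field of an integral scheme over `ℂ` is a `ℂ`-algebra. -/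
instance functionFieldAlgebra (X : Scheme.{0}) [IsIntegral X] [X.Over SpecC] :
    Algebra ℂ X.functionField :=
  RingHom.toAlgebra <|
    (X.presheaf.germ ⊤ (genericPoint X) trivial).hom.comp <|
      (X ↘ SpecC).appTop.hom.comp (Scheme.ΓSpecIso (CommRingCat.of ℂ)).inv.hom

/-- `h⁰(X, 𝒪_X(D))`: the dimension over `ℂ` of the space of rational functions `f` with `f = 0` or
`div f + D ≥ 0`. -/
def h0 {X : Scheme.{0}} [IsIntegral X] [IsLocallyNoetherian X] [X.Over SpecC]
    (D : WeilDivisor X) : Cardinal :=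
  Module.rank ℂ (Submodule.span ℂ {f : X.functionField | IsNonzeroSection D f})

/-- Nonzero constants have order zero along every prime divisor. -/
lemma ord_algebraMap (X : Scheme.{0}) [IsIntegral X] [IsLocallyNoetherian X] [X.Over SpecC]
    {a : ℂ} (ha : a ≠ 0) (x : X) : Scheme.ord (algebraMap ℂ X.functionField a) x = 0 := by
  have : Nonempty (⊤ : X.Opens) := ⟨⟨genericPoint X, trivial⟩⟩
  have hu : IsUnit (((X ↘ SpecC).appTop.hom.comp
      (Scheme.ΓSpecIso (CommRingCat.of ℂ)).inv.hom) a) := (IsUnit.mk0 a ha).map _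
  exact Scheme.ord_of_isUnit hu (U := ⊤) (x := x) trivial

/-- If the local rings at the prime divisors are discrete valuation rings (as they are on a normal,
in particular on a smooth, variety), then the sections in the above sense already form a subspace,
so that the span in the definition of `h0` only adds `0`. -/
lemma mem_span_isNonzeroSection_iff {X : Scheme.{0}} [IsIntegral X] [IsLocallyNoetherian X]
    [X.Over SpecC] [∀ E : PrimeDivisor X, IsDiscreteValuationRing (X.presheaf.stalk E.1)]
    (D : WeilDivisor X) (f : X.functionField) :
    f ∈ Submodule.span ℂ {f : X.functionField | IsNonzeroSection D f} ↔
      f = 0 ∨ IsNonzeroSection D f := by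
  constructor
  · intro h
    induction h using Submodule.span_induction with
    | mem f hf => exact Or.inr hf
    | zero => exact Or.inl rfl
    | add f g _ _ hf hg =>
      by_cases hfg : f + g = 0
      · exact Or.inl hfg
      rcases hf with rfl | hf
      · simpa using hg
      rcases hg with rfl | hg
      · simpa using Or.inr hf
      refine Or.inr ⟨hfg, fun E => ?_⟩
      have h1 := Scheme.ord_add (x := E.1) hfg
      have h2 := hf.2 E
      have h3 := hg.2 E
      rcases min_le_iff.mp h1 with h | h <;> omega
    | smul a f _ hf =>
      rcases hf with rfl | hf
      · simp
      by_cases ha : a = 0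
      · simp [ha]
      have ha' : algebraMap ℂ X.functionField a ≠ 0 := by simpa using ha
      refine Or.inr ⟨?_, fun E => ?_⟩
      · rw [Algebra.smul_def]
        exact mul_ne_zero ha' hf.1
      · rw [Algebra.smul_def, Scheme.ord_mul ha' hf.1, ord_algebraMap X ha, zero_add]
        exact hf.2 E
  · rintro (rfl | h)
    · exact Submodule.zero_mem _
    · exact Submodule.subset_span h

attribute [local instance] MvPolynomial.gradedAlgebra

/-- Projective `n`-space over `ℂ`. -/
abbrev projectiveSpace (n : ℕ) : Scheme.{0} :=
  Proj (MvPolynomial.homogeneousSubmodule (Fin (n + 1)) ℂ)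

/-- The structure morphism of projective space. -/
def projectiveSpaceToSpec (n : ℕ) : projectiveSpace n ⟶ SpecC :=
  Proj.toSpecZero (MvPolynomial.homogeneousSubmodule (Fin (n + 1)) ℂ) ≫
    Spec.map (CommRingCat.ofHom
      (algebraMap ℂ (MvPolynomial.homogeneousSubmodule (Fin (n + 1)) ℂ 0)))

/-- A scheme over `ℂ` is projective if it is a closed subscheme of some projective space. -/
def IsProjectiveOverC (X : Scheme.{0}) [X.Over SpecC] : Prop :=
  ∃ (n : ℕ) (i : X ⟶ projectiveSpace n),
    IsClosedImmersion i ∧ i ≫ projectiveSpaceToSpec n = X ↘ SpecC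

/-- The local ring at `x`, as a subring of the function field. -/
def localRing (X : Scheme.{0}) [IsIntegral X] (x : X) : Subring X.functionField :=
  (algebraMap (X.presheaf.stalk x) X.functionField).range

/-- The rational 3-form `da ∧ db ∧ dc`. -/
def threeForm {X : Scheme.{0}} [IsIntegral X] [X.Over SpecC] (a b c : X.functionField) :
    ⋀[X.functionField]^3 Ω[X.functionField⁄ℂ] :=
  exteriorPower.ιMulti X.functionField 3
    ![KaehlerDifferential.D ℂ X.functionField a, KaehlerDifferential.D ℂ X.functionField b,
      KaehlerDifferential.D ℂ X.functionField c]

/-- The canonical sheaf `⋀³ Ω_X` of a smooth threefold is trivial: viewing `⋀³ Ω_X` inside the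
constant sheaf of rational 3-forms, there is a form which generates its stalk at each point. -/
def HasTrivialCanonicalSheaf (X : Scheme.{0}) [IsIntegral X] [X.Over SpecC] : Prop :=
  ∃ η : ⋀[X.functionField]^3 Ω[X.functionField⁄ℂ], ∀ x : X,
    Submodule.span (localRing X x)
      {θ | ∃ a ∈ localRing X x, ∃ b ∈ localRing X x, ∃ c ∈ localRing X x, θ = threeForm a b c} =
    Submodule.span (localRing X x) {η}

/-- The structure sheaf as a sheaf of abelian groups. -/
def structureSheafAb (X : Scheme.{0}) : Sheaf (Opens.grothendieckTopology X) AddCommGrpCat.{0} :=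
  (sheafCompose (Opens.grothendieckTopology X) (forget₂ RingCat.{0} AddCommGrpCat.{0})).obj
    ((sheafCompose (Opens.grothendieckTopology X) (forget₂ CommRingCat.{0} RingCat.{0})).obj
      X.sheaf)

/-- A (smooth) Calabi--Yau threefold: a smooth projective complex variety of dimension three with
trivial canonical sheaf and `H¹(X, 𝒪_X) = H²(X, 𝒪_X) = 0`. -/
class IsCalabiYauThreefold (X : Scheme.{0}) [X.Over SpecC] : Prop extends IsIntegral X where
  projective : IsProjectiveOverC X
  smooth : SmoothOfRelativeDimension 3 (X ↘ SpecC)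
  trivial_canonical : HasTrivialCanonicalSheaf X
  cohomology_one : Subsingleton (Sheaf.H (structureSheafAb X) 1)
  cohomology_two : Subsingleton (Sheaf.H (structureSheafAb X) 2)

instance (X : Scheme.{0}) [X.Over SpecC] [IsCalabiYauThreefold X] : IsLocallyNoetherian X := by
  have : SmoothOfRelativeDimension 3 (X ↘ SpecC) := IsCalabiYauThreefold.smooth
  have : Smooth (X ↘ SpecC) := SmoothOfRelativeDimension.smooth 3 _
  have : IsLocallyNoetherian SpecC := inferInstance
  exact LocallyOfFiniteType.isLocallyNoetherian (X ↘ SpecC)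

end CYHoles

end

/-! A positive multiple `m • D` is linearly equivalent to some `G ≥ 0`: non-negative real relations
between integral classes can be replaced by rational ones (`exists_nsmul_mem_closure_of_mem_hull`).
Stable base components all occur in `G`, so they are finite in number. If there were none, every
component of `G` would be missing from some member of some `|k D|`; a common multiple of `D` would
then have base locus of codimension at least two, and `D` would be movable
(`nonempty_stableBaseComponents`).

The core is `lt_of_mem_stableBaseComponents`. Let `A` be supported on the stable base components and
let `F ≥ 0` lie in `|k(D + A)|`. If `B = k A - F` were non-negative at some stable base component,
subtracting from `G` the right rational multiple of `B` would give, up to scaling, an effective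
divisor in a multiple of `D` that misses a stable base component, which is absurd. So `F` exceeds `k
A` along each of them.

For `k = 1` and `A ≥ 0`, `F - A` would be effective in the class of `D`, so `D + A` remains a hole
and both `h0` vanish. For general `k`, no multiple of `D + A` has an effective member avoiding a
stable base component, whereas a movable class has one
(`exists_multiple_avoiding_of_isMovableClass`). Part (2) follows since a movable hole would be
effective. -/

namespace CYHoles

/-! ### Passing from real to integral relations -/

section Rationality

/-- Finitely many positive reals stay positive under a suitable `ℚ`-linear functional. -/
lemma exists_ratLinearMap_pos (s : Finset ℝ) (hs : ∀ r ∈ s, 0 < r) :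
    ∃ φ : ℝ →ₗ[ℚ] ℚ, ∀ r ∈ s, 0 < φ r := by
  let b := Module.Basis.ofVectorSpace ℚ ℝ
  -- Positivity at the finitely many `r` is an open condition on the images of a Hamel basis. The
  -- basis itself satisfies it, hence so does some rational point.
  let U : Set (Module.Basis.ofVectorSpaceIndex ℚ ℝ → ℝ) :=
    ⋂ r ∈ s, {q | 0 < ∑ i ∈ (b.repr r).support, ((b.repr r i : ℚ) : ℝ) * q i}
  have hU : IsOpen U := isOpen_biInter_finset fun r _ =>
    isOpen_lt continuous_const (by fun_prop)
  have hne : U.Nonempty := by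
    refine ⟨fun i => b i, Set.mem_iInter₂.2 fun r hr => ?_⟩
    have h := b.linearCombination_repr r
    rw [Finsupp.linearCombination_apply, Finsupp.sum] at h
    simp only [Rat.smul_def] at h
    simpa only [Set.mem_ofPred_eq, h] using hs r hr
  have hd : DenseRange (Pi.map fun (_ : Module.Basis.ofVectorSpaceIndex ℚ ℝ) (q : ℚ) => (q : ℝ)) :=
    DenseRange.piMap fun _ => Rat.denseRange_cast
  obtain ⟨q, hq⟩ := hd.exists_mem_open hU hne
  refine ⟨b.constr ℚ q, fun r hr => ?_⟩
  have h := Set.mem_iInter₂.1 hq r hr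
  rw [Module.Basis.constr_apply, Finsupp.sum]
  simp only [Set.mem_ofPred_eq, Pi.map_apply] at h
  simp only [smul_eq_mul]
  exact_mod_cast h

/-- If a lattice vector is a non-negative real combination of lattice vectors, then some positive
multiple of it is a sum of them. -/
lemma exists_nsmul_mem_closure_of_mem_hull {A : Type*} [AddCommGroup A] {S : Set A} {c : A}
    (h : (1 : ℝ) ⊗ₜ[ℤ] c ∈ PointedCone.hull ℝ ((fun a : A => (1 : ℝ) ⊗ₜ[ℤ] a) '' S)) :
    ∃ N : ℕ, 0 < N ∧ N • c ∈ AddSubmonoid.closure S := by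
  obtain ⟨r, hrS, hr0, hr⟩ := PointedCone.mem_hull_set.1 h
  -- The element `1` is included because `φ 1` becomes the coefficient of `c` after applying `φ ⊗
  -- id`.
  obtain ⟨φ, hφ⟩ := exists_ratLinearMap_pos (insert 1 (r.support.image r)) (by
    intro x hx
    rcases Finset.mem_insert.1 hx with rfl | hx
    · exact one_pos
    · obtain ⟨y, hy, rfl⟩ := Finset.mem_image.1 hx
      exact lt_of_le_of_ne (hr0 y) (Finsupp.mem_support_iff.1 hy).symm)
  let P : ℚ ⊗[ℤ] A → Prop := fun x =>
    ∃ M : ℕ, 0 < M ∧ ∃ d ∈ AddSubmonoid.closure S, M • x = (1 : ℚ) ⊗ₜ[ℤ] d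
  have hP : P (φ 1 ⊗ₜ[ℤ] c) := by
    have h1 : φ 1 ⊗ₜ[ℤ] c =
        (φ.toAddMonoidHom.toIntLinearMap.rTensor A) ((1 : ℝ) ⊗ₜ[ℤ] c) := rfl
    rw [h1, ← hr, Finsupp.sum, map_sum]
    refine Finset.sum_induction _ P ?_ ⟨1, one_pos, 0, zero_mem _, by simp⟩ ?_
    · rintro x y ⟨M, hM, d, hd, hx⟩ ⟨M', hM', d', hd', hy⟩
      refine ⟨M * M', mul_pos hM hM', M' • d + M • d',
        add_mem (nsmul_mem hd _) (nsmul_mem hd' _), ?_⟩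
      rw [smul_add, mul_comm M M', mul_smul, hx, mul_comm M' M, mul_smul, hy,
        TensorProduct.tmul_add, TensorProduct.tmul_smul, TensorProduct.tmul_smul]
    · intro y hy
      obtain ⟨a, ha, rfl⟩ := hrS hy
      have hpos := hφ _ (Finset.mem_insert_of_mem (Finset.mem_image_of_mem r hy))
      set t := r ((1 : ℝ) ⊗ₜ[ℤ] a)
      refine ⟨(φ t).den, (φ t).den_pos, (φ t).num.toNat • a,
        nsmul_mem (AddSubmonoid.subset_closure ha) _, ?_⟩
      have h2 : (φ.toAddMonoidHom.toIntLinearMap.rTensor A) (t • ((1 : ℝ) ⊗ₜ[ℤ] a)) =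
          φ t ⊗ₜ[ℤ] a := by
        rw [TensorProduct.smul_tmul', smul_eq_mul, mul_one]; rfl
      rw [h2, TensorProduct.smul_tmul', TensorProduct.tmul_smul, TensorProduct.smul_tmul']
      congr 1
      have h3 : (((φ t).num.toNat : ℤ) : ℚ) = (φ t).num := by
        rw [Int.toNat_of_nonneg (Rat.num_nonneg.2 hpos.le)]
      rw [nsmul_eq_mul, nsmul_eq_mul, mul_one, Rat.den_mul_eq_num, ← h3, Int.cast_natCast]
  obtain ⟨M, hM, d, hd, hMd⟩ := hP
  have hpos := hφ 1 (Finset.mem_insert_self _ _)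
  obtain ⟨p, hp⟩ := Int.eq_ofNat_of_zero_le (Rat.num_nonneg.2 hpos.le)
  have hp0 : 0 < p := by have := Rat.num_pos.2 hpos; omega
  have h4 : (1 : ℚ) ⊗ₜ[ℤ] ((M * p) • c) = (1 : ℚ) ⊗ₜ[ℤ] ((φ 1).den • d) := by
    rw [TensorProduct.tmul_smul (φ 1).den, ← hMd, TensorProduct.tmul_smul,
      TensorProduct.smul_tmul', TensorProduct.smul_tmul', TensorProduct.smul_tmul']
    congr 1
    have h5 := Rat.den_mul_eq_num (φ 1)
    rw [hp] at h5
    push_cast at h5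
    simp only [nsmul_eq_mul, mul_one]
    push_cast
    rw [← h5]
    ring
  have h6 : TensorProduct.mk ℤ ℚ A 1 ((M * p) • c) = TensorProduct.mk ℤ ℚ A 1 ((φ 1).den • d) := h4
  -- `ℚ ⊗ A` is the localization of `A` at the nonzero integers, so equality there holds in `A` up
  -- to torsion, killed by `k`.
  obtain ⟨k, hk⟩ := (IsLocalizedModule.eq_iff_exists (nonZeroDivisors ℤ) _).1 h6
  have hk0 : (k : ℤ) ≠ 0 := nonZeroDivisors.coe_ne_zero k
  have hk' : (k : ℤ).natAbs • ((M * p) • c) = (k : ℤ).natAbs • ((φ 1).den • d) := by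
    have hk2 : (k : ℤ) • ((M * p) • c) = (k : ℤ) • ((φ 1).den • d) := hk
    rcases Int.natAbs_eq (k : ℤ) with h | h <;> rw [h] at hk2
    · simpa only [natCast_zsmul] using hk2
    · simpa only [neg_smul, neg_inj, natCast_zsmul] using hk2
  refine ⟨(k : ℤ).natAbs * (M * p), by positivity, ?_⟩
  rw [mul_smul, hk']
  exact nsmul_mem (nsmul_mem hd _) _

end Rationality

/-! ### Finiteness of the divisor of a rational function -/

section Finiteness

variable {X : Scheme.{0}}

/-- The generic point is the top of this order, so `coheight` measures codimension. -/
lemma le_iff_mem_closure {x y : X} : x ≤ y ↔ x ∈ closure {y} :=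
  specializes_iff_mem_closure

lemma PrimeDivisor.eq_of_mem_closure {E E' : PrimeDivisor X} (h : E.1 ∈ closure {E'.1}) :
    E = E' := by
  have hle : E.1 ≤ E'.1 := le_iff_mem_closure.2 h
  by_contra hne
  have hlt : E.1 < E'.1 := lt_of_le_not_ge hle fun h' =>
    hne (Subtype.ext (Specializes.antisymm h' hle).eq)
  have := coheight_add_one_le hlt
  rw [E.2, E'.2] at this
  exact absurd this (by decide)

lemma PrimeDivisor.one_le_coheight_of_mem_closure {E : PrimeDivisor X} {x : X} (hx : x ∈ closure {E.1}) :
    1 ≤ coheight x :=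
  E.2.symm.le.trans (coheight_anti (le_iff_mem_closure.2 hx))

/-- A codimension-one point of a proper closed set must be the generic point of an irreducible
component containing it, and there are finitely many components. -/
lemma finite_primeDivisor_of_isClosed [IsIntegral X] [NoetherianSpace X] {Z : Set X}
    (hZ : IsClosed Z) (hη : genericPoint X ∉ Z) : {E : PrimeDivisor X | E.1 ∈ Z}.Finite := by
  obtain ⟨S, hS, hSc, hSi, rfl⟩ := NoetherianSpace.exists_finite_set_isClosed_irreducible hZ
  classical
  refine Set.Finite.subset
    (hS.biUnion fun t _ => (Set.Subsingleton.finite (s := {E : PrimeDivisor X | closure {E.1} = t})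
      ?_)) ?_
  · intro E hE E' hE'
    refine PrimeDivisor.eq_of_mem_closure ?_
    rw [Set.mem_ofPred_eq] at hE hE'
    rw [hE', ← hE]
    exact subset_closure rfl
  · rintro E ⟨t, ht, hE⟩
    refine Set.mem_iUnion₂.2 ⟨t, ht, ?_⟩
    obtain ⟨z, hz⟩ := QuasiSober.sober (hSi t ht) (hSc t ht)
    have hzt : z ∈ t := hz ▸ subset_closure rfl
    have hEz : E.1 ≤ z := le_iff_mem_closure.2 (hz.symm ▸ hE)
    have hzη : z < genericPoint X := by
      refine lt_of_le_not_ge (genericPoint_specializes z) fun h => hη ⟨t, ht, ?_⟩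
      rw [← hz]
      exact le_iff_mem_closure.1 h
    have hzE : z ≤ E.1 := by
      by_contra hn
      have h1 := coheight_add_one_le (lt_of_le_not_ge hEz hn)
      have h2 := coheight_add_one_le hzη
      rw [E.2] at h1
      have h3 : (1 : ℕ∞) ≤ coheight z := le_trans le_add_self h2
      exact absurd ((add_le_add_left h3 1).trans h1) (by decide)
    refine subset_antisymm ?_ ?_
    · exact (hSc t ht).closure_subset_iff.2 (Set.singleton_subset_iff.2 hE)
    · rw [← hz]
      exact isClosed_closure.closure_subset_iff.2
        (Set.singleton_subset_iff.2 (le_iff_mem_closure.1 hzE))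

/-- On the nonempty open set where a local representative of `f` is invertible, all orders vanish.
-/
lemma finite_support_ord [IsIntegral X] [IsLocallyNoetherian X] [NoetherianSpace X]
    {f : X.functionField} (hf : f ≠ 0) :
    {E : PrimeDivisor X | Scheme.ord f E.1 ≠ 0}.Finite := by
  obtain ⟨V, hV, s, rfl⟩ := X.presheaf.exists_germ_eq f
  have hη : genericPoint X ∈ X.basicOpen s := (X.mem_basicOpen s _ hV).2 (IsUnit.mk0 _ hf)
  refine (finite_primeDivisor_of_isClosed (X.basicOpen s).isOpen.isClosed_compl
    (fun h => h hη)).subset fun E hE hmem => hE ?_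
  have : Nonempty (X.basicOpen s) := ⟨⟨_, hη⟩⟩
  have h := Scheme.ord_of_isUnit (U := X.basicOpen s) (RingedSpace.isUnit_res_basicOpen _ s) (x := E.1) hmem
  rw [← h]
  congr 1
  exact (X.presheaf.germ_res_apply (homOfLE (X.basicOpen_le s)) _ hη s).symm

end Finiteness

/-! ### Projective schemes are quasi-compact -/

section Compactness

attribute [local instance] MvPolynomial.gradedAlgebra

lemma compactSpace_projectiveSpace (n : ℕ) : CompactSpace (projectiveSpace n) := by
  have : Algebra.FiniteType (MvPolynomial.homogeneousSubmodule (Fin (n + 1)) ℂ 0)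
      (MvPolynomial (Fin (n + 1)) ℂ) :=
    have : IsScalarTower ℂ (MvPolynomial.homogeneousSubmodule (Fin (n + 1)) ℂ 0)
        (MvPolynomial (Fin (n + 1)) ℂ) := ⟨fun a x y => smul_mul_assoc a x.1 y⟩
    Algebra.FiniteType.of_restrictScalars_finiteType ℂ _ _
  have : QuasiCompact (Proj.toSpecZero (MvPolynomial.homogeneousSubmodule (Fin (n + 1)) ℂ)) :=
    inferInstance
  exact QuasiCompact.compactSpace_of_compactSpace
    (Proj.toSpecZero (MvPolynomial.homogeneousSubmodule (Fin (n + 1)) ℂ))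

lemma IsProjectiveOverC.compactSpace {X : Scheme.{0}} [X.Over SpecC] (h : IsProjectiveOverC X) :
    CompactSpace X := by
  obtain ⟨n, i, hi, -⟩ := h
  have := compactSpace_projectiveSpace n
  exact QuasiCompact.compactSpace_of_compactSpace i

end Compactness

/-! ### Sections and effective divisors in a class -/

section Sections

variable {X : Scheme.{0}} [IsIntegral X] [IsLocallyNoetherian X]

lemma exists_section_of_class_eq {D F : WeilDivisor X} (hF : 0 ≤ F)
    (h : divisorClass F = divisorClass D) :
    ∃ f : X.functionField, IsNonzeroSection D f ∧ ∀ E, Scheme.ord f E.1 + D E = F E := by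
  obtain ⟨f, hf, hfE⟩ := (QuotientAddGroup.eq (s := principalDivisors X)).1 h.symm
  have hE : ∀ E, Scheme.ord f E.1 + D E = F E := fun E => by
    rw [← hfE E, Finsupp.add_apply, Finsupp.neg_apply]
    ring
  exact ⟨f, ⟨hf, fun E => (hE E).symm ▸ hF E⟩, hE⟩

/-- Finiteness of the support of `div f` makes `div f + D` a genuine divisor. -/
lemma IsNonzeroSection.exists_divisor [NoetherianSpace X] {D : WeilDivisor X}
    {f : X.functionField} (hf : IsNonzeroSection D f) :
    ∃ F : WeilDivisor X, 0 ≤ F ∧ divisorClass F = divisorClass D ∧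
      ∀ E, Scheme.ord f E.1 + D E = F E := by
  classical
  let P : WeilDivisor X := Finsupp.onFinset (finite_support_ord hf.1).toFinset
    (fun E => Scheme.ord f E.1) fun E hE => by simpa using hE
  refine ⟨P + D, fun E => hf.2 E, ?_, fun E => rfl⟩
  refine ((QuotientAddGroup.eq (s := principalDivisors X)).2 ?_).symm
  exact ⟨f, hf.1, fun E => by simp [P]⟩

lemma isEffectiveClass_iff_exists_section [NoetherianSpace X] {D : WeilDivisor X} :
    IsEffectiveClass (divisorClass D) ↔ ∃ f, IsNonzeroSection D f := by
  constructor
  · rintro ⟨F, hF, h⟩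
    exact (exists_section_of_class_eq hF h).imp fun _ => And.left
  · rintro ⟨f, hf⟩
    obtain ⟨F, hF, h, -⟩ := hf.exists_divisor
    exact ⟨F, hF, h⟩

lemma mem_baseLocus_iff [NoetherianSpace X] {D : WeilDivisor X} {x : X} :
    x ∈ baseLocus D ↔ ∀ F : WeilDivisor X, 0 ≤ F → divisorClass F = divisorClass D →
      ∃ E : PrimeDivisor X, F E ≠ 0 ∧ x ∈ closure {E.1} := by
  constructor
  · intro h F hF hFD
    obtain ⟨f, hf, hfE⟩ := exists_section_of_class_eq hF hFD
    obtain ⟨E, hE, hx⟩ := h f hf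
    exact ⟨E, hfE E ▸ hE, hx⟩
  · intro h f hf
    obtain ⟨F, hF, hFD, hfE⟩ := hf.exists_divisor
    obtain ⟨E, hE, hx⟩ := h F hF hFD
    exact ⟨E, (hfE E).symm ▸ hE, hx⟩

lemma closure_subset_baseLocus {D : WeilDivisor X} {x : X} (hx : x ∈ baseLocus D) :
    closure {x} ⊆ baseLocus D := by
  intro y hy f hf
  obtain ⟨E, hE, hxE⟩ := hx f hf
  exact ⟨E, hE, isClosed_closure.closure_subset_iff.2 (Set.singleton_subset_iff.2 hxE) hy⟩

/-- A prime divisor lies in the base locus if and only if it is a fixed component. -/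
lemma PrimeDivisor.mem_baseLocus_iff [NoetherianSpace X] {D : WeilDivisor X}
    {E : PrimeDivisor X} :
    E.1 ∈ baseLocus D ↔
      ∀ F : WeilDivisor X, 0 ≤ F → divisorClass F = divisorClass D → F E ≠ 0 := by
  rw [CYHoles.mem_baseLocus_iff]
  refine forall₃_congr fun F _ _ => ⟨?_, fun h => ⟨E, h, subset_closure rfl⟩⟩
  rintro ⟨E', hE', h⟩
  rwa [PrimeDivisor.eq_of_mem_closure h]

/-- Base loci are closed under specialization, so it suffices to test the generic point of `E`. -/
lemma mem_stableBaseComponents_iff [NoetherianSpace X] {D : WeilDivisor X}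
    {E : PrimeDivisor X} :
    E ∈ stableBaseComponents D ↔ ∀ m : ℕ, 0 < m → ∀ F : WeilDivisor X, 0 ≤ F →
      divisorClass F = m • divisorClass D → F E ≠ 0 := by
  simp only [stableBaseComponents, stableBaseLocus, Set.mem_ofPred_eq, Set.subset_iInter_iff]
  refine forall₂_congr fun m _ => ?_
  rw [show m • divisorClass D = divisorClass (m • D) from rfl, ← PrimeDivisor.mem_baseLocus_iff]
  exact ⟨fun h => h (subset_closure rfl), closure_subset_baseLocus⟩

end Sections

/-! ### Effective and movable cones; existence of stable base components -/

section Cones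

variable {X : Scheme.{0}} [IsIntegral X] [IsLocallyNoetherian X]

lemma toReal_add_mem_effectiveCone {D A : WeilDivisor X}
    (hD : (divisorClass D).toReal ∈ effectiveCone X) (hA : 0 ≤ A) :
    (divisorClass (D + A)).toReal ∈ effectiveCone X := by
  have hAmem : (divisorClass A).toReal ∈ effectiveCone X := by
    let τ : WeilDivisor X →+ RealClass X :=
      (TensorProduct.mk ℤ ℝ (DivisorClass X) 1).toAddMonoidHom.comp
        (QuotientAddGroup.mk' (principalDivisors X))
    change τ A ∈ effectiveCone X
    rw [← A.sum_single, Finsupp.sum, map_sum]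
    refine sum_mem fun E _ => ?_
    have hE : Finsupp.single E (A E) = (A E).toNat • (Finsupp.single E 1 : WeilDivisor X) := by
      rw [Finsupp.smul_single, nsmul_one]
      congr 1
      exact (Int.toNat_of_nonneg (hA E)).symm
    rw [hE, map_nsmul]
    exact nsmul_mem (PointedCone.subset_hull (Set.mem_range_self E)) _
  have : (divisorClass (D + A)).toReal = (divisorClass D).toReal + (divisorClass A).toReal :=
    TensorProduct.tmul_add (1 : ℝ) (divisorClass D) (divisorClass A)
  rw [this]
  exact add_mem hD hAmem

lemma exists_effective_multiple {D : WeilDivisor X}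
    (h : (divisorClass D).toReal ∈ effectiveCone X) :
    ∃ m : ℕ, 0 < m ∧ ∃ G : WeilDivisor X, 0 ≤ G ∧ divisorClass G = m • divisorClass D := by
  have h' := exists_nsmul_mem_closure_of_mem_hull
    (S := Set.range fun E : PrimeDivisor X => divisorClass (Finsupp.single E 1 : WeilDivisor X))
    (c := divisorClass D) (by rw [← Set.range_comp]; exact h)
  obtain ⟨m, hm, hmem⟩ := h'
  refine ⟨m, hm, ?_⟩
  generalize m • divisorClass D = c₀ at hmem ⊢
  induction hmem using AddSubmonoid.closure_induction with
  | mem c hc =>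
    obtain ⟨E, rfl⟩ := hc
    exact ⟨Finsupp.single E 1, Finsupp.single_nonneg.2 zero_le_one, rfl⟩
  | zero => exact ⟨0, le_rfl, rfl⟩
  | add c d _ _ hc hd =>
    obtain ⟨G, hG, rfl⟩ := hc
    obtain ⟨G', hG', rfl⟩ := hd
    exact ⟨G + G', add_nonneg hG hG', rfl⟩

/-- A movable class has a positive multiple represented by an effective divisor avoiding any
given prime divisor. -/
lemma exists_multiple_avoiding_of_isMovableClass [NoetherianSpace X] {D : WeilDivisor X}
    (h : IsMovableClass (divisorClass D)) (E : PrimeDivisor X) :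
    ∃ m : ℕ, 0 < m ∧ ∃ F : WeilDivisor X, 0 ≤ F ∧ divisorClass F = m • divisorClass D ∧
      F E = 0 := by
  have h' := exists_nsmul_mem_closure_of_mem_hull
    (S := {c : DivisorClass X | ∃ M : WeilDivisor X, IsEffectiveClass (divisorClass M) ∧
      (∀ x ∈ baseLocus M, 2 ≤ coheight x) ∧ c = divisorClass M})
    (c := divisorClass D) (by
      refine Submodule.span_mono ?_ h
      rintro v ⟨M, hM, hbs, rfl⟩
      exact ⟨divisorClass M, ⟨M, hM, hbs, rfl⟩, rfl⟩)
  obtain ⟨m, hm, hmem⟩ := h'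
  refine ⟨m, hm, ?_⟩
  generalize m • divisorClass D = c₀ at hmem ⊢
  induction hmem using AddSubmonoid.closure_induction with
  | mem c hc =>
    obtain ⟨M, hM, hbs, rfl⟩ := hc
    have hE : E.1 ∉ baseLocus M := fun hE => by
      have := hbs _ hE
      rw [E.2] at this
      exact absurd this (by decide)
    rw [PrimeDivisor.mem_baseLocus_iff] at hE
    push Not at hE
    exact hE
  | zero => exact ⟨0, le_rfl, rfl, rfl⟩
  | add c d _ _ hc hd =>
    obtain ⟨F, hF, rfl, hFE⟩ := hc
    obtain ⟨F', hF', rfl, hFE'⟩ := hd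
    exact ⟨F + F', add_nonneg hF hF', rfl, by rw [Finsupp.add_apply, hFE, hFE', add_zero]⟩

lemma finite_stableBaseComponents [NoetherianSpace X] {D : WeilDivisor X}
    (h : (divisorClass D).toReal ∈ effectiveCone X) : (stableBaseComponents D).Finite := by
  obtain ⟨m, hm, G, hG, hGD⟩ := exists_effective_multiple h
  exact G.support.finite_toSet.subset fun E hE =>
    Finsupp.mem_support_iff.2 (mem_stableBaseComponents_iff.1 hE m hm G hG hGD)

/-- The `k`-fold multiple of a member of `|m D|` lies in `|k m D|` and has no new components. -/
lemma baseLocus_mul_subset [NoetherianSpace X] {D : WeilDivisor X} {m k : ℕ} :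
    baseLocus ((k * m) • D) ⊆ baseLocus (m • D) := by
  intro x hx
  rw [mem_baseLocus_iff] at hx ⊢
  intro F hF hFD
  obtain ⟨E, hE, hxE⟩ := hx (k • F) (nsmul_nonneg hF k) (by
    rw [mul_smul]
    exact congrArg (k • ·) hFD)
  refine ⟨E, fun h => hE ?_, hxE⟩
  rw [Finsupp.smul_apply, h, smul_zero]

lemma nonempty_stableBaseComponents [NoetherianSpace X] {D : WeilDivisor X}
    (h : (divisorClass D).toReal ∈ effectiveCone X) (hD : ¬ IsMovableClass (divisorClass D)) :
    (stableBaseComponents D).Nonempty := by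
  by_contra hne
  rw [Set.not_nonempty_iff_eq_empty] at hne
  obtain ⟨m, hm, G, hG, hGD⟩ := exists_effective_multiple h
  have hk : ∀ E : PrimeDivisor X, ∃ k : ℕ, 0 < k ∧ E.1 ∉ baseLocus (k • D) := fun E => by
    have hE : E ∉ stableBaseComponents D := hne ▸ Set.notMem_empty E
    rw [mem_stableBaseComponents_iff] at hE
    push Not at hE
    obtain ⟨k, hk, F, hF, hFD, hFE⟩ := hE
    exact ⟨k, hk, fun h => PrimeDivisor.mem_baseLocus_iff.1 h F hF hFD hFE⟩
  choose k hk hkE using hk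
  -- Every `k E` divides `K`, so no component of `G` is fixed in `|K m D|`; and `K • G` shows that
  -- the base locus lies in the support of `G`.
  set K := ∏ E ∈ G.support, k E
  have hK : 0 < K := Finset.prod_pos fun E _ => hk E
  have hKm : 0 < K * m := mul_pos hK hm
  refine hD ?_
  have hmem : (divisorClass ((K * m) • D)).toReal ∈ movableCone X := by
    refine PointedCone.subset_hull ⟨(K * m) • D, ⟨K • G, nsmul_nonneg hG _, ?_⟩, fun x hx => ?_, rfl⟩
    · rw [mul_smul]
      exact congrArg (K • ·) hGD
    · obtain ⟨E, hE, hxE⟩ := mem_baseLocus_iff.1 (baseLocus_mul_subset hx) G hG hGD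
      have h1 := PrimeDivisor.one_le_coheight_of_mem_closure hxE
      rcases h1.lt_or_eq with h1 | h1
      · exact Order.add_one_le_of_lt h1
      · have hEx : (⟨x, h1.symm⟩ : PrimeDivisor X) = E := PrimeDivisor.eq_of_mem_closure hxE
        obtain ⟨l, hl⟩ := Finset.dvd_prod_of_mem k (Finsupp.mem_support_iff.2 hE)
        have hK' : K = k E * l := hl
        rw [hK', mul_assoc, mul_comm] at hx
        refine absurd (baseLocus_mul_subset hx) ?_
        have := hkE E
        rwa [← hEx] at this ⊢
  have hsmul : (divisorClass D).toReal =
      ((K * m : ℕ) : ℝ)⁻¹ • (divisorClass ((K * m) • D)).toReal := by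
    have : (divisorClass ((K * m) • D)).toReal = ((K * m : ℕ) : ℝ) • (divisorClass D).toReal := by
      rw [Nat.cast_smul_eq_nsmul]
      exact TensorProduct.tmul_smul (K * m) (1 : ℝ) (divisorClass D)
    rw [this, inv_smul_smul₀ (Nat.cast_ne_zero.2 hKm.ne')]
  rw [IsMovableClass, hsmul]
  exact (movableCone X).smul_mem (inv_nonneg.2 (Nat.cast_nonneg _)) hmem

end Cones

/-! ### Rigidity under adding stable base components -/

section Rigidity

variable {X : Scheme.{0}} [IsIntegral X] [IsLocallyNoetherian X] [NoetherianSpace X]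

/-- Adding stable base components to a divisor `D` only produces effective divisors having these
components with at least the added multiplicities, strictly more at each stable base component. -/
lemma lt_of_mem_stableBaseComponents {D A F : WeilDivisor X} {k : ℕ} (hk : 0 < k)
    (hD : (divisorClass D).toReal ∈ effectiveCone X)
    (hA : ∀ E ∈ A.support, E ∈ stableBaseComponents D)
    (hF : 0 ≤ F) (hFD : divisorClass F = k • divisorClass (D + A))
    {E : PrimeDivisor X} (hE : E ∈ stableBaseComponents D) : k * A E < F E := by
  classical
  by_contra! hle
  obtain ⟨m, hm, G, hG, hGD⟩ := exists_effective_multiple hD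
  have hGpos : ∀ E ∈ stableBaseComponents D, 0 < G E := fun E hE =>
    lt_of_le_of_ne (hG E) (mem_stableBaseComponents_iff.1 hE m hm G hG hGD).symm
  set B : WeilDivisor X := k • A - F with hB
  have hBE : ∀ E, B E = k * A E - F E := fun E => by simp [hB]
  have hT : ∀ E' ∈ insert E A.support, E' ∈ stableBaseComponents D := fun E' hE' => by
    rcases Finset.mem_insert.1 hE' with rfl | h
    exacts [hE, hA _ h]
  -- Maximizing `B / G` picks the component where `G - t B` first reaches zero as `t` grows. `E` is
  -- inserted because `A` need not contain it.
  obtain ⟨E₀, hE₀, hmax⟩ := Finset.exists_max_image (insert E A.support)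
    (fun E => (B E : ℚ) / G E) ⟨E, Finset.mem_insert_self _ _⟩
  have hcross : ∀ E' ∈ insert E A.support, B E' * G E₀ ≤ B E₀ * G E' := fun E' hE' => by
    have h := hmax E' hE'
    rw [div_le_div_iff₀ (by exact_mod_cast hGpos _ (hT _ hE'))
      (by exact_mod_cast hGpos _ (hT _ hE₀))] at h
    exact_mod_cast h
  have hG₀ := hGpos _ (hT _ hE₀)
  have hB₀ : 0 ≤ B E₀ := by
    have h := hcross E (Finset.mem_insert_self _ _)
    have h1 : 0 ≤ B E := by rw [hBE]; omega
    exact nonneg_of_mul_nonneg_left ((mul_nonneg h1 hG₀.le).trans h) (hGpos _ hE)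
  obtain ⟨x, hx⟩ := Int.eq_ofNat_of_zero_le hB₀
  obtain ⟨y, hy⟩ := Int.eq_ofNat_of_zero_le hG₀.le
  have hy0 : 0 < y := by omega
  have hH : ∀ E', (x • G - y • B) E' = B E₀ * G E' - G E₀ * B E' := fun E' => by
    rw [hx, hy]; simp
  -- With `x = B E₀` and `y = G E₀`, the divisor `x G - y B` vanishes at `E₀`. Since `B` has class
  -- `-k D`, its class is `(x m + y k) D`, a positive multiple even when `x = 0`.
  refine mem_stableBaseComponents_iff.1 (hT _ hE₀) (x * m + y * k)
    (Nat.add_pos_right _ (mul_pos hy0 hk)) (x • G - y • B) (fun E' => ?_) ?_ ?_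
  · rw [hH, Finsupp.coe_zero, Pi.zero_apply, sub_nonneg, mul_comm]
    by_cases hE' : E' ∈ insert E A.support
    · exact hcross E' hE'
    -- Away from `A`, `B = -F ≤ 0`, so subtracting `y B` does no harm.
    · have hA' : A E' = 0 := by
        by_contra h
        exact hE' (Finset.mem_insert_of_mem (Finsupp.mem_support_iff.2 h))
      have h1 : B E' ≤ 0 := by
        have := hF E'
        rw [Finsupp.coe_zero, Pi.zero_apply] at this
        rw [hBE, hA']
        omega
      exact (mul_nonpos_of_nonpos_of_nonneg h1 hG₀.le).trans (mul_nonneg hB₀ (hG E'))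
  · have key : ∀ {M : Type} [AddCommGroup M] (d a f g : M), f = k • (d + a) → g = m • d →
        x • g - y • (k • a - f) = (x * m + y * k) • d := by
      rintro M _ d a f g rfl rfl
      rw [smul_add, sub_add_cancel_right, smul_neg, sub_neg_eq_add, add_smul, mul_smul, mul_smul]
    exact key (divisorClass D) (divisorClass A) _ _ hFD hGD
  · rw [hH, mul_comm, sub_self]

lemma IsHole.h0_eq_zero [X.Over SpecC] {D : WeilDivisor X} (h : IsHole (divisorClass D)) :
    h0 D = 0 := by
  have : {f : X.functionField | IsNonzeroSection D f} = ∅ :=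
    Set.eq_empty_of_forall_notMem fun f hf =>
      h.2 (isEffectiveClass_iff_exists_section.2 ⟨f, hf⟩)
  rw [h0, this, Submodule.span_empty, rank_bot]

lemma IsHole.add_stableBaseComponents {D A : WeilDivisor X} (h : IsHole (divisorClass D))
    (hA0 : 0 ≤ A) (hA : ∀ E ∈ A.support, E ∈ stableBaseComponents D) :
    IsHole (divisorClass (D + A)) := by
  refine ⟨toReal_add_mem_effectiveCone h.1 hA0, ?_⟩
  rintro ⟨F, hF, hFD⟩
  refine h.2 ⟨F - A, fun E => ?_, ?_⟩
  · rw [Finsupp.coe_zero, Pi.zero_apply, Finsupp.sub_apply, sub_nonneg]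
    by_cases hE : E ∈ A.support
    · have := lt_of_mem_stableBaseComponents one_pos h.1 hA hF (by rw [hFD, one_smul]) (hA E hE)
      rw [Nat.cast_one, one_mul] at this
      exact this.le
    · rw [Finsupp.notMem_support_iff.1 hE]
      exact hF E
  · have : divisorClass (F - A) = divisorClass F - divisorClass A := rfl
    rw [this, hFD]
    exact add_sub_cancel_right (divisorClass D) (divisorClass A)

lemma not_isMovableClass_add_stableBaseComponents {D A : WeilDivisor X}
    (hD : (divisorClass D).toReal ∈ effectiveCone X)
    (hne : (stableBaseComponents D).Nonempty) (hA0 : 0 ≤ A)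
    (hA : ∀ E ∈ A.support, E ∈ stableBaseComponents D) :
    ¬ IsMovableClass (divisorClass (D + A)) := by
  intro hmov
  obtain ⟨E, hE⟩ := hne
  obtain ⟨k, hk, F, hF, hFD, hFE⟩ := exists_multiple_avoiding_of_isMovableClass hmov E
  have h1 := lt_of_mem_stableBaseComponents hk hD hA hF hFD hE
  rw [hFE] at h1
  exact h1.not_ge (mul_nonneg (Nat.cast_nonneg _) (hA0 E))

theorem exists_stableBaseComponents_of_nonmovable_hole [X.Over SpecC] {D : WeilDivisor X}
    (h : IsHole (divisorClass D)) (hD : ¬ IsMovableClass (divisorClass D)) :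
    ∃ (n : ℕ) (E : Fin n → PrimeDivisor X),
      0 < n ∧ Function.Injective E ∧ Set.range E = stableBaseComponents D ∧
      ∀ a : Fin n → ℕ,
        h0 (D + ∑ i, Finsupp.single (E i) (a i : ℤ)) = h0 D ∧
        IsHole (divisorClass (D + ∑ i, Finsupp.single (E i) (a i : ℤ))) ∧
        ¬ IsMovableClass (divisorClass (D + ∑ i, Finsupp.single (E i) (a i : ℤ))) := by
  classical
  have hfin := finite_stableBaseComponents h.1
  have hne := nonempty_stableBaseComponents h.1 hD
  have := hfin.to_subtype
  obtain ⟨n, ⟨e⟩⟩ := Finite.exists_equiv_fin (stableBaseComponents D)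
  have hrange : Set.range (fun i => (e.symm i).1) = stableBaseComponents D := by
    rw [show (fun i => (e.symm i).1) = Subtype.val ∘ e.symm from rfl, Set.range_comp,
      e.symm.range_eq_univ, Set.image_univ, Subtype.range_val]
  refine ⟨n, fun i => (e.symm i).1, ?_, Subtype.val_injective.comp e.symm.injective, hrange,
    fun a => ?_⟩
  · exact Fin.pos (e ⟨_, hne.choose_spec⟩)
  · set A : WeilDivisor X := ∑ i, Finsupp.single (e.symm i).1 (a i : ℤ)
    have hA0 : 0 ≤ A := Finset.sum_nonneg fun i _ =>
      Finsupp.single_nonneg.2 (Nat.cast_nonneg _)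
    have hA : ∀ E ∈ A.support, E ∈ stableBaseComponents D := fun E hE => by
      obtain ⟨i, -, hi⟩ := Finset.mem_biUnion.1 (Finsupp.support_finsetSum hE)
      have := Finset.mem_singleton.1 (Finsupp.support_single_subset hi)
      exact this ▸ (e.symm i).2
    have hhole := h.add_stableBaseComponents hA0 hA
    exact ⟨hhole.h0_eq_zero.trans h.h0_eq_zero.symm, hhole,
      not_isMovableClass_add_stableBaseComponents h.1 hne hA0 hA⟩

end Rigidity

end CYHoles

open AlgebraicGeometry CYHoles in
theorem mainTheorem2 (X : Scheme.{0}) [X.Over SpecC] [IsCalabiYauThreefold X] :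
    (∀ D : WeilDivisor X, IsHole (divisorClass D) → ¬ IsMovableClass (divisorClass D) →
      ∃ (n : ℕ) (E : Fin n → PrimeDivisor X),
        0 < n ∧ Function.Injective E ∧ Set.range E = stableBaseComponents D ∧
        ∀ a : Fin n → ℕ,
          h0 (D + ∑ i, Finsupp.single (E i) (a i : ℤ)) = h0 D ∧
          IsHole (divisorClass (D + ∑ i, Finsupp.single (E i) (a i : ℤ))) ∧
          ¬ IsMovableClass (divisorClass (D + ∑ i, Finsupp.single (E i) (a i : ℤ)))) ∧
    ((∀ c : DivisorClass X, IsMovableClass c → IsEffectiveClass c) →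
      ∀ D : WeilDivisor X, IsHole (divisorClass D) →
        ∃ (n : ℕ) (E : Fin n → PrimeDivisor X),
          0 < n ∧ Function.Injective E ∧ Set.range E = stableBaseComponents D ∧
          ∀ a : Fin n → ℕ,
            h0 (D + ∑ i, Finsupp.single (E i) (a i : ℤ)) = h0 D ∧
            IsHole (divisorClass (D + ∑ i, Finsupp.single (E i) (a i : ℤ))) ∧
            ¬ IsMovableClass (divisorClass (D + ∑ i, Finsupp.single (E i) (a i : ℤ)))) := by
  -- Projectivity gives quasi-compactness, which with local Noetherianity makes `X` Noetherian.
  have : CompactSpace X := (IsCalabiYauThreefold.projective (X := X)).compactSpace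
  have : IsNoetherian X := { }
  exact ⟨fun _ h hD => exists_stableBaseComponents_of_nonmovable_hole h hD,
    fun hmov _ h => exists_stableBaseComponents_of_nonmovable_hole h fun hD => h.2 (hmov _ hD)⟩
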